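/- Let $\mathcal G=(\mathcal V,\mathcal E)$ be a directed graph with $\mathcal V=\{1,\dots,n\}$ and $\mathcal E\subseteq\mathcal V\times\mathcal V$ (self-loops allowed), and let $\gamma_1,\dots,\gamma_n\in\mathbb R$, $\Gamma=\mathrm{diag}(\gamma_1,\dots,\gamma_n)$. For real edge weights $a=(a_{ij})_{(j,i)\in\mathcal E}$ let $A\in\mathbb R^{n\times n}$ be the matrix with $[A]_{ij}=a_{ij}$ if $(j,i)\in\mathcal E$ and $[A]_{ij}=0$ otherwise, and let $$\varphi(a)=\delta_M\big((sI-\Gamma)(sI-\Gamma-A)^{-1}\big),$$ where $\delta_M(G)$ denotes the McMillan degree of a real rational matrix $G(s)$: the sum, over the distinct poles $p\in\mathbb C\cup\{\infty\}$ of the entries of $G$, of the largest multiplicity of $p$ as a pole of a minor of $G$. The structural complexity $\varphi_{\mathcal G}$ is the maximum of $\varphi(a)$ over all real edge weights $a\in\mathbb R^{\mathcal E}$. Let $\gamma_1^*,\dots,\gamma_k^*$ be the distinct values among $\gamma_1,\dots,\gamma_n$, let $\mathcal P_i=\{j\in\mathcal V:\gamma_j=\gamma_i^*\}$, and let $\mathcal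 G_i=(\mathcal V,\mathcal E_i)$, where $\mathcal E_i$ is the set of the edges of $\mathcal G$ whose start node lies in $\mathcal P_i$. The matching number $\nu(\mathcal H)$ of a directed graph $\mathcal H$ is the largest cardinality of a set of its edges in which no two distinct edges share a start node or an end node. Theorem. The maximum defining $\varphi_{\mathcal G}$ exists; it is also the generic value of $\varphi$, that is, there is a nonzero real polynomial in the edge weights such that $\varphi(a)=\varphi_{\mathcal G}$ for every $a\in\mathbb R^{\mathcal E}$ at which it does not vanish; and $$\varphi_{\mathcal G}=\sum_{i=1}^k\nu(\mathcal G_i).$$ -/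

import Mathlib

open scoped OnePoint

noncomputable section

namespace NetworkComplexity

/-! ### Poles and McMillan degree of real rational matrices -/

/-- The multiplicity of `p ∈ ℂ ∪ {∞}` as a pole of the scalar real rational function `f`
(it is `0` if `p` is not a pole). As `f.num` and `f.denom` are coprime, a finite `z` is a pole of
multiplicity equal to its multiplicity as a root of the denominator. At infinity it is the
excess of the degree of the numerator over that of the denominator (truncated subtraction:
a proper `f` has no pole there). -/
def poleMultiplicity : OnePoint ℂ → RatFunc ℝ → ℕ
  | ∞, f => f.num.natDegree - f.denom.natDegree
  | OnePoint.some z, f => (f.denom.map (algebraMap ℝ ℂ)).rootMultiplicity z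

/-- `p ∈ ℂ ∪ {∞}` is a pole of `G(s)` if it is a pole of some entry. -/
def IsPole {q m : ℕ} (G : Matrix (Fin q) (Fin m) (RatFunc ℝ)) (p : OnePoint ℂ) : Prop :=
  ∃ i j, 0 < poleMultiplicity p (G i j)

/-- The degree `δ(G; p)`: the largest multiplicity of `p` as a pole over all minors of `G(s)`.
A minor is the determinant of the `k × k` submatrix on `k` distinct rows and `k` distinct columns;
the order in which these are listed only affects the sign. -/
def poleDegree {q m : ℕ} (G : Matrix (Fin q) (Fin m) (RatFunc ℝ)) (p : OnePoint ℂ) : ℕ :=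
  (Finset.range (min q m + 1)).sup fun k =>
    Finset.univ.sup fun r : Fin k ↪ Fin q =>
      Finset.univ.sup fun c : Fin k ↪ Fin m =>
        poleMultiplicity p (G.submatrix r c).det

/-- A real rational matrix has finitely many poles. -/
theorem finite_poles {q m : ℕ} (G : Matrix (Fin q) (Fin m) (RatFunc ℝ)) :
    {p : OnePoint ℂ | IsPole G p}.Finite := by
  have key : ∀ f : RatFunc ℝ, {p : OnePoint ℂ | 0 < poleMultiplicity p f}.Finite := by
    intro f
    have hne : f.denom.map (algebraMap ℝ ℂ) ≠ 0 :=
      (Polynomial.map_ne_zero_iff (algebraMap ℝ ℂ).injective).2 f.denom_ne_zero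
    refine Set.Finite.subset (((f.denom.map (algebraMap ℝ ℂ)).roots.toFinset.finite_toSet.image
      (OnePoint.some : ℂ → OnePoint ℂ)).insert ∞) ?_
    intro p hp
    induction p using OnePoint.rec with
    | infty => exact Set.mem_insert _ _
    | coe z =>
      refine Set.mem_insert_of_mem _ ⟨z, ?_, rfl⟩
      have hz : 0 < (f.denom.map (algebraMap ℝ ℂ)).rootMultiplicity z := hp
      simpa [hne] using (Polynomial.rootMultiplicity_pos hne).1 hz
  have h : {p : OnePoint ℂ | IsPole G p} =
      ⋃ i, ⋃ j, {p : OnePoint ℂ | 0 < poleMultiplicity p (G i j)} := by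
    ext p
    simp [IsPole]
  rw [h]
  exact Set.finite_iUnion fun i => Set.finite_iUnion fun j => key (G i j)

/-- The McMillan degree `δ_M(G)`: the sum of the degrees of the distinct poles of `G(s)`,
including a possible pole at infinity. -/
def mcMillanDegree {q m : ℕ} (G : Matrix (Fin q) (Fin m) (RatFunc ℝ)) : ℕ :=
  ∑ p ∈ (finite_poles G).toFinset, poleDegree G p

/-! ### Directed graphs on `Fin n`; `G.Adj v w` means that there is an edge from `v` to `w`,
self-loops being allowed -/

/-- A matching: a set of edges, no two of which share a start node or an end node. -/
def IsMatching {n : ℕ} (G : Digraph (Fin n)) (M : Finset (Fin n × Fin n)) : Prop :=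
  (∀ e ∈ M, G.Adj e.1 e.2) ∧ ∀ e ∈ M, ∀ f ∈ M, e ≠ f → e.1 ≠ f.1 ∧ e.2 ≠ f.2

open Classical in
/-- The matching number `ν(G)`: the largest cardinality of a matching. -/
def matchingNumber {n : ℕ} (G : Digraph (Fin n)) : ℕ :=
  (Finset.univ.filter fun M : Finset (Fin n × Fin n) => IsMatching G M).sup Finset.card

/-- The subgraph of `G` on all nodes whose edges are the edges of `G` pointing out of nodes
of `P`. -/
def outgoingSubgraph {n : ℕ} (G : Digraph (Fin n)) (P : Set (Fin n)) : Digraph (Fin n) where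
  Adj v w := v ∈ P ∧ G.Adj v w

/-! ### The network system `ẋ = (Γ + A) x + u` and its complexity -/

/-- The edges of `G`, as ordered pairs (start node, end node). -/
abbrev Edge {n : ℕ} (G : Digraph (Fin n)) : Type :=
  {e : Fin n × Fin n // G.Adj e.1 e.2}

open Classical in
/-- The matrix `A` for the edge weights `a`: its `(i, j)` entry is the weight of the edge from
`j` to `i` if this is an edge, and zero otherwise. -/
def weightMatrix {n : ℕ} (G : Digraph (Fin n)) (a : Edge G → ℝ) : Matrix (Fin n) (Fin n) ℝ :=
  Matrix.of fun i j => if h : G.Adj j i then a ⟨(j, i), h⟩ else 0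

/-- The matrix `sI - M` over `ℝ(s)`, for a real matrix `M`. -/
def sSub {n : ℕ} (M : Matrix (Fin n) (Fin n) ℝ) : Matrix (Fin n) (Fin n) (RatFunc ℝ) :=
  Matrix.scalar (Fin n) RatFunc.X - M.map RatFunc.C

/-- `sI - M` is invertible over `ℝ(s)`, so its matrix inverse is the genuine one. -/
theorem isUnit_det_sSub {n : ℕ} (M : Matrix (Fin n) (Fin n) ℝ) : IsUnit (sSub M).det := by
  have h : sSub M = (algebraMap (Polynomial ℝ) (RatFunc ℝ)).mapMatrix M.charmatrix := by
    ext i j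
    by_cases hij : i = j
    · subst hij
      simp [sSub]
    · simp [sSub, hij]
  rw [h, ← RingHom.map_det, isUnit_iff_ne_zero]
  exact RatFunc.algebraMap_ne_zero (Matrix.charpoly_monic M).ne_zero

/-- The filtered transfer function `(sI - Γ)(sI - Γ - A)⁻¹`, where `Γ = diag(γ₁, …, γₙ)`. -/
def filteredTransfer {n : ℕ} (γ : Fin n → ℝ) (A : Matrix (Fin n) (Fin n) ℝ) :
    Matrix (Fin n) (Fin n) (RatFunc ℝ) :=
  sSub (Matrix.diagonal γ) * (sSub (Matrix.diagonal γ + A))⁻¹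

/-- The complexity `φ` of the network system with node parameters `γ`, graph `G` and
edge weights `a`. -/
def complexity {n : ℕ} (γ : Fin n → ℝ) (G : Digraph (Fin n)) (a : Edge G → ℝ) : ℕ :=
  mcMillanDegree (filteredTransfer γ (weightMatrix G a))

/-- The structural complexity `φ_G`: the maximum of the complexity over all real edge weights. -/
def structuralComplexity {n : ℕ} (γ : Fin n → ℝ) (G : Digraph (Fin n)) : ℕ :=
  sSup (Set.range fun a : Edge G → ℝ => complexity γ G a)

end NetworkComplexity

end

noncomputable section

namespace NetworkComplexity

/-! ### Rank of a matrix over a field -/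

/-! The transfer function `G` is hard to read, but its inverse `K = I - A (sI - Γ)⁻¹` is explicit:
column `j` has at most a simple pole, at `γ j`. Jacobi's complementary minor theorem says that `det
K` times a minor of `G` is, up to sign, a minor of `K`; hence at every finite `z` the pole degree of
`G` is that of `K` plus the order of `det K` at `z` (`poleDegree_eq_add_order_det`). Since `det K`
is a quotient of two characteristic polynomials of degree `n`, its orders over all finite points sum
to zero, and `G` is proper, so its McMillan degree is the sum of the pole degrees of `K` over `ℂ`.

Near `c`, `K` is a regular matrix minus `(s - c)⁻¹ A_c`, where `A_c` keeps the columns `j` of `A`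
with `γ j = c`. Its pole degree there is the rank of `A_c` (`poleDegree_filteredInverse`), so the
complexity is the sum of these ranks (`mcMillanDegree_filteredTransfer`).

What remains is generic rank. The rank of `A_c` never exceeds the matching number of the graph
supporting it, because a nonzero term of a nonzero minor is a matching; a maximum matching
conversely gives a minor that is a nonzero polynomial in the weights. The product of these
polynomials over all `c` makes all ranks maximal at once. -/

theorem exists_linearIndependent_cols {K m n : Type*} [Field K] [Finite m] [Fintype n]
    (A : Matrix m n K) :
    ∃ c : Fin A.rank ↪ n, LinearIndependent K (fun i => A.col (c i)) ∧
      Submodule.span K (Set.range fun i => A.col (c i)) =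
        Submodule.span K (Set.range A.col) := by
  have h := Submodule.exists_fun_fin_finrank_span_eq K (Set.range A.col)
  rw [← A.rank_eq_finrank_span_cols] at h
  obtain ⟨f, hf, hspan, hli⟩ := h
  choose c hc using hf
  have hcf : (fun i => A.col (c i)) = f := funext hc
  refine ⟨⟨c, fun i j hij => hli.injective ?_⟩, ?_, ?_⟩
  · rw [← hc i, ← hc j, hij]
  · rw [← hcf] at hli
    exact hli
  · exact (congrArg (fun g => Submodule.span K (Set.range g)) hcf).trans hspan

/-- Rank factorization. -/
theorem exists_eq_mul_of_rank {K m n : Type*} [Field K] [Finite m] [Fintype n]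
    (A : Matrix m n K) :
    ∃ (B : Matrix m (Fin A.rank) K) (C : Matrix (Fin A.rank) n K), A = B * C := by
  obtain ⟨c, -, hspan⟩ := exists_linearIndependent_cols A
  have h : ∀ j, ∃ w : Fin A.rank → K, ∑ i, w i • A.col (c i) = A.col j := fun j => by
    rw [← Submodule.mem_span_range_iff_exists_fun, hspan]
    exact Submodule.subset_span ⟨j, rfl⟩
  choose w hw using h
  refine ⟨A.submatrix id c, Matrix.of fun i j => w j i, ?_⟩
  ext i j
  have := congrFun (hw j) i
  simp only [Finset.sum_apply, Pi.smul_apply, Matrix.col_apply, smul_eq_mul] at this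
  simp [Matrix.mul_apply, ← this, mul_comm]

/-- A matrix has a nonzero minor whose size is the rank. -/
theorem exists_submatrix_det_ne_zero {K m n : Type*} [Field K] [Fintype m] [Fintype n]
    (A : Matrix m n K) :
    ∃ (r : Fin A.rank ↪ m) (c : Fin A.rank ↪ n), (A.submatrix r c).det ≠ 0 := by
  obtain ⟨c, hc, -⟩ := exists_linearIndependent_cols A
  have hB : (A.submatrix id c).transpose.rank = A.rank := by
    simpa using LinearIndependent.rank_matrix (M := (A.submatrix id c).transpose) hc
  obtain ⟨r, hr, -⟩ := exists_linearIndependent_cols (A.submatrix id c).transpose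
  refine ⟨(finCongr hB.symm).toEmbedding.trans r, c, ?_⟩
  rw [← isUnit_iff_ne_zero, ← Matrix.isUnit_iff_isUnit_det,
    ← Matrix.linearIndependent_rows_iff_isUnit]
  exact hr.comp _ (finCongr hB.symm).injective

/-! ### The order of a real rational function at a complex point -/

/-- The order of vanishing of `f` at `z`, negative if `z` is a pole (junk for `f = 0`). -/
def order (z : ℂ) (f : RatFunc ℝ) : ℤ :=
  (f.num.map (algebraMap ℝ ℂ)).rootMultiplicity z -
    (f.denom.map (algebraMap ℝ ℂ)).rootMultiplicity z

theorem map_complex_ne_zero {p : Polynomial ℝ} (hp : p ≠ 0) : p.map (algebraMap ℝ ℂ) ≠ 0 :=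
  (Polynomial.map_ne_zero_iff (algebraMap ℝ ℂ).injective).2 hp

theorem rootMultiplicity_map_mul (z : ℂ) {p q : Polynomial ℝ} (hp : p ≠ 0) (hq : q ≠ 0) :
    ((p * q).map (algebraMap ℝ ℂ)).rootMultiplicity z =
      (p.map (algebraMap ℝ ℂ)).rootMultiplicity z +
        (q.map (algebraMap ℝ ℂ)).rootMultiplicity z := by
  rw [Polynomial.map_mul, Polynomial.rootMultiplicity_mul
    (mul_ne_zero (map_complex_ne_zero hp) (map_complex_ne_zero hq))]

theorem order_mul (z : ℂ) {f g : RatFunc ℝ} (hf : f ≠ 0) (hg : g ≠ 0) :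
    order z (f * g) = order z f + order z g := by
  have h := congrArg (fun p : Polynomial ℝ => (p.map (algebraMap ℝ ℂ)).rootMultiplicity z)
    (RatFunc.num_denom_mul f g)
  have hf' := RatFunc.num_ne_zero hf
  have hg' := RatFunc.num_ne_zero hg
  have hfg := RatFunc.num_ne_zero (mul_ne_zero hf hg)
  have df := RatFunc.denom_ne_zero f
  have dg := RatFunc.denom_ne_zero g
  have dfg := RatFunc.denom_ne_zero (f * g)
  rw [rootMultiplicity_map_mul z hfg (mul_ne_zero df dg), rootMultiplicity_map_mul z df dg,
    rootMultiplicity_map_mul z (mul_ne_zero hf' hg') dfg,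
    rootMultiplicity_map_mul z hf' hg'] at h
  unfold order
  omega

theorem order_algebraMap (z : ℂ) (p : Polynomial ℝ) :
    order z (algebraMap (Polynomial ℝ) (RatFunc ℝ) p) =
      (p.map (algebraMap ℝ ℂ)).rootMultiplicity z := by
  simp [order, Polynomial.rootMultiplicity_eq_zero]

theorem order_one (z : ℂ) : order z 1 = 0 := by
  simpa [Polynomial.rootMultiplicity_eq_zero] using order_algebraMap z 1

theorem order_neg (z : ℂ) (f : RatFunc ℝ) : order z (-f) = order z f := by
  by_cases hf : f = 0
  · simp [hf]
  have h : order z (-1) = 0 := by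
    simpa [Polynomial.rootMultiplicity_eq_zero] using order_algebraMap z (-1)
  rw [neg_eq_neg_one_mul, order_mul z (by simp) hf, h, zero_add]

theorem order_pow (z : ℂ) {f : RatFunc ℝ} (hf : f ≠ 0) (k : ℕ) :
    order z (f ^ k) = k * order z f := by
  induction k with
  | zero => simp [order_one]
  | succ k ih => rw [pow_succ, order_mul z (pow_ne_zero k hf) hf, ih]; push_cast; ring

theorem neg_order_le (z : ℂ) (f : RatFunc ℝ) : -order z f ≤ poleMultiplicity z f := by
  simp only [order, poleMultiplicity]
  omega

/-- Numerator and denominator are coprime, also over `ℂ`, so the numerator does not vanish at a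
pole. -/
theorem neg_order_eq (z : ℂ) {f : RatFunc ℝ} (h : 0 < poleMultiplicity z f) :
    -order z f = poleMultiplicity z f := by
  have hd := (Polynomial.rootMultiplicity_pos (map_complex_ne_zero f.denom_ne_zero)).1
    (show 0 < (f.denom.map (algebraMap ℝ ℂ)).rootMultiplicity z from h)
  have hn : (f.num.map (algebraMap ℝ ℂ)).rootMultiplicity z = 0 := by
    refine Polynomial.rootMultiplicity_eq_zero fun hroot => ?_
    have hc := f.isCoprime_num_denom.map (Polynomial.mapRingHom (algebraMap ℝ ℂ))
    obtain ⟨a, b, hab⟩ := hc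
    have := congrArg (Polynomial.eval z) hab
    simp only [Polynomial.coe_mapRingHom, Polynomial.eval_add, Polynomial.eval_mul,
      Polynomial.eval_one] at this
    rw [hroot.eq_zero, hd.eq_zero] at this
    simp at this
  simp [order, poleMultiplicity, hn]

/-- The rational functions without a pole at `z`. -/
def regularAt (z : ℂ) : Subring (RatFunc ℝ) where
  carrier := {f | Polynomial.aeval z f.denom ≠ 0}
  mul_mem' {f g} hf hg h := by
    obtain ⟨q, hq⟩ := RatFunc.denom_mul_dvd f g
    have := congrArg (Polynomial.aeval z) hq
    simp only [map_mul, h, zero_mul, mul_eq_zero] at this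
    exact this.elim hf hg
  add_mem' {f g} hf hg h := by
    obtain ⟨q, hq⟩ := RatFunc.denom_add_dvd f g
    have := congrArg (Polynomial.aeval z) hq
    simp only [map_mul, h, zero_mul, mul_eq_zero] at this
    exact this.elim hf hg
  one_mem' := by simp
  zero_mem' := by simp
  neg_mem' {f} hf h := by
    obtain ⟨q, hq⟩ : (-f).denom ∣ f.denom := by
      have h1 := RatFunc.denom_mul_dvd (algebraMap (Polynomial ℝ) (RatFunc ℝ) (-1)) f
      rwa [RatFunc.denom_algebraMap, one_mul, map_neg, map_one, neg_one_mul] at h1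
    have := congrArg (Polynomial.aeval z) hq
    simp only [map_mul, h, zero_mul] at this
    exact hf this

theorem mem_regularAt_iff {z : ℂ} {f : RatFunc ℝ} :
    f ∈ regularAt z ↔ poleMultiplicity z f = 0 := by
  change Polynomial.aeval z f.denom ≠ 0 ↔
    (f.denom.map (algebraMap ℝ ℂ)).rootMultiplicity z = 0
  rw [Polynomial.rootMultiplicity_eq_zero_iff, Polynomial.IsRoot.def, Polynomial.eval_map_algebraMap]
  have := map_complex_ne_zero f.denom_ne_zero
  tauto

theorem algebraMap_mem_regularAt (z : ℂ) (p : Polynomial ℝ) :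
    algebraMap (Polynomial ℝ) (RatFunc ℝ) p ∈ regularAt z := by
  change Polynomial.aeval z _ ≠ 0
  simp

theorem div_mem_regularAt {z : ℂ} (p : Polynomial ℝ) {q : Polynomial ℝ}
    (hq : Polynomial.aeval z q ≠ 0) :
    algebraMap (Polynomial ℝ) (RatFunc ℝ) p / algebraMap (Polynomial ℝ) (RatFunc ℝ) q ∈
      regularAt z := by
  intro h
  obtain ⟨t, ht⟩ := RatFunc.denom_div_dvd p q
  have := congrArg (Polynomial.aeval z) ht
  simp only [map_mul, h, zero_mul] at this
  exact hq this

theorem order_nonneg_of_mem_regularAt {z : ℂ} {f : RatFunc ℝ} (hf : f ∈ regularAt z) :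
    0 ≤ order z f := by
  have := neg_order_le z f
  rw [mem_regularAt_iff.1 hf] at this
  simpa using this

theorem det_mem_of_forall_mem {R ι : Type*} [CommRing R] [Fintype ι] [DecidableEq ι]
    (S : Subring R) {M : Matrix ι ι R} (h : ∀ i j, M i j ∈ S) : M.det ∈ S := by
  rw [Matrix.det_apply]
  exact S.sum_mem fun σ _ => by
    rw [Units.smul_def]
    exact S.zsmul_mem (S.prod_mem fun i _ => h _ _) _

/-! ### Complementary minors of inverse matrices -/

/-- Used to reorder rows and columns so that a given minor becomes the leading block. -/
theorem exists_sumEquiv_extending {n k l : ℕ} (h : k + l = n) (r : Fin k ↪ Fin n) :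
    ∃ e : Fin k ⊕ Fin l ≃ Fin n, ∀ i, e (Sum.inl i) = r i := by
  classical
  have hcard : Fintype.card ↥(Set.range r)ᶜ = l := by
    rw [Fintype.card_compl_set, Set.card_range_of_injective r.injective]
    simp
    omega
  let e₁ : Fin k ≃ Set.range r := Equiv.ofInjective r r.injective
  let e₂ : Fin l ≃ ↥(Set.range r)ᶜ := (Fintype.equivFinOfCardEq hcard).symm
  exact ⟨(Equiv.sumCongr e₁ e₂).trans (Equiv.Set.sumCompl (Set.range r)), fun i => rfl⟩

theorem det_submatrix_equiv_equiv {R m n : Type*} [CommRing R] [Fintype m] [DecidableEq m]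
    [Fintype n] [DecidableEq n] (e₁ e₂ : n ≃ m) (A : Matrix m m R) :
    (A.submatrix e₁ e₂).det = A.det ∨ (A.submatrix e₁ e₂).det = -A.det := by
  have hee : e₂ = e₁.trans (e₁.symm.trans e₂) := by ext; simp
  have h : (A.submatrix e₁ e₂).det =
      Equiv.Perm.sign (e₁.symm.trans e₂) * A.det := by
    conv_lhs => rw [hee]
    change ((A.submatrix id (e₁.symm.trans e₂)).submatrix e₁ e₁).det = _
    rw [Matrix.det_submatrix_equiv_self, Matrix.det_permute']
  rw [h]
  rcases Int.units_eq_one_or (Equiv.Perm.sign (e₁.symm.trans e₂)) with h | h <;> simp [h]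

/-- **Jacobi's complementary minor theorem**, up to sign. -/
theorem exists_complementary_minor {R : Type*} [CommRing R] {n k : ℕ}
    {K G : Matrix (Fin n) (Fin n) R} (h : K * G = 1) (r c : Fin k ↪ Fin n) :
    ∃ (l : ℕ) (r' c' : Fin l ↪ Fin n),
      K.det * (G.submatrix r c).det = (K.submatrix r' c').det ∨
      K.det * (G.submatrix r c).det = -(K.submatrix r' c').det := by
  have hk : k ≤ n := by simpa using Fintype.card_le_of_embedding r
  obtain ⟨er, hr⟩ := exists_sumEquiv_extending (Nat.add_sub_cancel' hk) r
  obtain ⟨ec, hc⟩ := exists_sumEquiv_extending (Nat.add_sub_cancel' hk) c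
  refine ⟨n - k, Function.Embedding.inr.trans ec.toEmbedding,
    Function.Embedding.inr.trans er.toEmbedding, ?_⟩
  set K' := K.submatrix ec er with hK'
  set G' := G.submatrix er ec with hG'
  have h1 : K' * G' = 1 := by
    rw [hK', hG', Matrix.submatrix_mul_equiv, h, Matrix.submatrix_one_equiv]
  have hG11 : G'.toBlocks₁₁ = G.submatrix r c := by
    ext i j
    simp [hG', Matrix.toBlocks₁₁, hr, hc]
  have hK22 : K'.toBlocks₂₂ = K.submatrix (Function.Embedding.inr.trans ec.toEmbedding)
      (Function.Embedding.inr.trans er.toEmbedding) := by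
    ext i j
    simp [hK', Matrix.toBlocks₂₂]
  rw [← Matrix.fromBlocks_toBlocks K', ← Matrix.fromBlocks_toBlocks G',
    Matrix.fromBlocks_multiply, ← Matrix.fromBlocks_one, Matrix.fromBlocks_inj] at h1
  -- Replacing the second block column of `G'` by that of the identity makes both the factor and the
  -- product block triangular, so determinants compare `G'₁₁` with `K'₂₂`.
  have h2 : K' * Matrix.fromBlocks G'.toBlocks₁₁ 0 G'.toBlocks₂₁ 1 =
      Matrix.fromBlocks 1 K'.toBlocks₁₂ 0 K'.toBlocks₂₂ := by
    conv_lhs => rw [← Matrix.fromBlocks_toBlocks K']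
    rw [Matrix.fromBlocks_multiply]
    simp [h1.1, h1.2.2.1]
  have h3 := congrArg Matrix.det h2
  rw [Matrix.det_mul, Matrix.det_fromBlocks_zero₁₂, Matrix.det_fromBlocks_zero₂₁, Matrix.det_one,
    mul_one, Matrix.det_one, one_mul, hG11, hK22] at h3
  rcases det_submatrix_equiv_equiv ec er K with hd | hd
  · left
    rw [← h3, hK', hd]
  · right
    rw [← h3, hK', hd]
    ring

/-! ### The degree of a pole -/

theorem poleMultiplicity_det_le {n k : ℕ} (G : Matrix (Fin n) (Fin n) (RatFunc ℝ))
    (p : OnePoint ℂ) (r c : Fin k ↪ Fin n) :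
    poleMultiplicity p (G.submatrix r c).det ≤ poleDegree G p := by
  have hk : k ≤ n := by simpa using Fintype.card_le_of_embedding r
  have h1 : k ∈ Finset.range (min n n + 1) := by simp; omega
  refine le_trans ?_ (Finset.le_sup (f := fun k => Finset.univ.sup fun r : Fin k ↪ Fin n =>
      Finset.univ.sup fun c : Fin k ↪ Fin n => poleMultiplicity p (G.submatrix r c).det) h1)
  refine le_trans ?_ (Finset.le_sup (f := fun r : Fin k ↪ Fin n =>
      Finset.univ.sup fun c : Fin k ↪ Fin n => poleMultiplicity p (G.submatrix r c).det)
      (Finset.mem_univ r))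
  exact Finset.le_sup (f := fun c : Fin k ↪ Fin n => poleMultiplicity p (G.submatrix r c).det)
      (Finset.mem_univ c)

theorem poleDegree_le {n m : ℕ} {G : Matrix (Fin n) (Fin n) (RatFunc ℝ)} {p : OnePoint ℂ}
    (h : ∀ (k : ℕ) (r c : Fin k ↪ Fin n), poleMultiplicity p (G.submatrix r c).det ≤ m) :
    poleDegree G p ≤ m :=
  Finset.sup_le fun k _ => Finset.sup_le fun r _ => Finset.sup_le fun c _ => h k r c

/-- The pole degree is attained as minus the order of a nonzero minor. -/
theorem exists_minor_order_eq {n : ℕ} (G : Matrix (Fin n) (Fin n) (RatFunc ℝ)) (z : ℂ) :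
    ∃ (k : ℕ) (r c : Fin k ↪ Fin n), (G.submatrix r c).det ≠ 0 ∧
      -order z (G.submatrix r c).det = poleDegree G z := by
  by_contra! hcon
  -- The empty minor is `1`, of order `0`; it attains a pole degree of zero.
  have h0 : poleDegree G z ≠ 0 := by
    intro h0
    have := hcon 0 Function.Embedding.ofIsEmpty Function.Embedding.ofIsEmpty (by simp)
    simp [order_one, h0] at this
  have : poleDegree G z ≤ poleDegree G z - 1 := poleDegree_le fun k r c => by
    have hle := poleMultiplicity_det_le G z r c
    rcases Nat.eq_zero_or_pos (poleMultiplicity z (G.submatrix r c).det) with hz | hpos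
    · omega
    · have hne : (G.submatrix r c).det ≠ 0 := by
        intro h
        rw [h] at hpos
        exact hpos.ne' (mem_regularAt_iff.1 (zero_mem _))
      have h1 := hcon k r c hne
      have h2 := neg_order_eq z hpos
      omega
  omega

theorem neg_order_minor_le {n k : ℕ} (G : Matrix (Fin n) (Fin n) (RatFunc ℝ)) (z : ℂ)
    (r c : Fin k ↪ Fin n) : -order z (G.submatrix r c).det ≤ poleDegree G z :=
  (neg_order_le z _).trans (by exact_mod_cast poleMultiplicity_det_le G z r c)

/-- Take a minor of `G` attaining the degree: its order is that of the complementary minor of `K`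
minus the order of `det K`. -/
theorem poleDegree_le_add_order_det {n : ℕ} {K G : Matrix (Fin n) (Fin n) (RatFunc ℝ)}
    (h : K * G = 1) (z : ℂ) : (poleDegree G z : ℤ) ≤ poleDegree K z + order z K.det := by
  obtain ⟨k, r, c, hne, hord⟩ := exists_minor_order_eq G z
  have hK : K.det ≠ 0 := by
    intro h0
    have := congrArg Matrix.det h
    rw [Matrix.det_mul, h0, zero_mul, Matrix.det_one] at this
    exact zero_ne_one this
  obtain ⟨l, r', c', hl⟩ := exists_complementary_minor h r c
  have h1 := neg_order_minor_le K z r' c'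
  have h2 : order z (K.submatrix r' c').det = order z K.det + order z (G.submatrix r c).det := by
    rw [← order_mul z hK hne]
    rcases hl with hl | hl
    · rw [hl]
    · rw [hl, order_neg]
  omega

/-- The inequality holds with `K` and `G` exchanged as well, and the orders of their determinants
are opposite. -/
theorem poleDegree_eq_add_order_det {n : ℕ} {K G : Matrix (Fin n) (Fin n) (RatFunc ℝ)}
    (h : K * G = 1) (z : ℂ) : (poleDegree G z : ℤ) = poleDegree K z + order z K.det := by
  have h1 := poleDegree_le_add_order_det h z
  have h2 := poleDegree_le_add_order_det (mul_eq_one_comm.1 h) z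
  have h3 : order z K.det + order z G.det = 0 := by
    have hd : K.det * G.det = 1 := by rw [← Matrix.det_mul, h, Matrix.det_one]
    rw [← order_mul z (left_ne_zero_of_mul_eq_one hd) (right_ne_zero_of_mul_eq_one hd), hd,
      order_one]
  omega

theorem poleDegree_eq_zero_of_forall_mem {n : ℕ} {G : Matrix (Fin n) (Fin n) (RatFunc ℝ)} {z : ℂ}
    (h : ∀ i j, G i j ∈ regularAt z) : poleDegree G z = 0 :=
  Nat.le_zero.1 <| poleDegree_le fun _ _ _ =>
    (mem_regularAt_iff.1 (det_mem_of_forall_mem _ fun _ _ => h _ _)).le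

theorem mem_regularAt_of_not_isPole {n : ℕ} {G : Matrix (Fin n) (Fin n) (RatFunc ℝ)} {z : ℂ}
    (h : ¬IsPole G z) (i j : Fin n) : G i j ∈ regularAt z :=
  mem_regularAt_iff.2 (Nat.eq_zero_of_not_pos fun hp => h ⟨i, j, hp⟩)

/-! ### The inverse of the filtered transfer function -/

/-- The matrix `I - A (sI - Γ)⁻¹`, the inverse of the filtered transfer function. -/
def filteredInverse {n : ℕ} (γ : Fin n → ℝ) (A : Matrix (Fin n) (Fin n) ℝ) :
    Matrix (Fin n) (Fin n) (RatFunc ℝ) :=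
  Matrix.of fun i j => (if i = j then 1 else 0) -
    RatFunc.C (A i j) / (RatFunc.X - RatFunc.C (γ j))

/-- The matrix of the columns `j` of `A` with `γ j = c`, the other columns being set to zero. -/
def columnPart {n : ℕ} (γ : Fin n → ℝ) (A : Matrix (Fin n) (Fin n) ℝ) (c : ℝ) :
    Matrix (Fin n) (Fin n) ℝ :=
  Matrix.of fun i j => if γ j = c then A i j else 0

theorem columnPart_apply {n : ℕ} (γ : Fin n → ℝ) (A : Matrix (Fin n) (Fin n) ℝ) (c : ℝ)
    (i j : Fin n) : columnPart γ A c i j = if γ j = c then A i j else 0 := rfl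

theorem X_sub_C_eq (c : ℝ) : (RatFunc.X - RatFunc.C c : RatFunc ℝ) =
    algebraMap (Polynomial ℝ) (RatFunc ℝ) (Polynomial.X - Polynomial.C c) := by
  simp

theorem X_sub_C_ne_zero (c : ℝ) : (RatFunc.X - RatFunc.C c : RatFunc ℝ) ≠ 0 := by
  rw [X_sub_C_eq]
  exact RatFunc.algebraMap_ne_zero (Polynomial.X_sub_C_ne_zero c)

theorem order_X_sub_C (c : ℝ) : order (c : ℂ) (RatFunc.X - RatFunc.C c) = 1 := by
  rw [X_sub_C_eq, order_algebraMap]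
  simp [Polynomial.rootMultiplicity_X_sub_C_self]

theorem C_div_mem_regularAt {z : ℂ} {b : ℝ} (hz : (b : ℂ) ≠ z) (a : ℝ) :
    RatFunc.C a / (RatFunc.X - RatFunc.C b) ∈ regularAt z := by
  rw [X_sub_C_eq, ← RatFunc.algebraMap_C]
  refine div_mem_regularAt _ ?_
  simpa [sub_eq_zero] using hz.symm

theorem C_mem_regularAt (z : ℂ) (a : ℝ) : (RatFunc.C a : RatFunc ℝ) ∈ regularAt z := by
  rw [← RatFunc.algebraMap_C]
  exact algebraMap_mem_regularAt z _

theorem ite_mem_regularAt (z : ℂ) (p : Prop) [Decidable p] :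
    (if p then 1 else 0 : RatFunc ℝ) ∈ regularAt z := by
  split_ifs
  · exact one_mem _
  · exact zero_mem _

theorem sSub_eq_map {n : ℕ} (M : Matrix (Fin n) (Fin n) ℝ) :
    sSub M = (algebraMap (Polynomial ℝ) (RatFunc ℝ)).mapMatrix M.charmatrix := by
  ext i j
  by_cases hij : i = j
  · subst hij
    simp [sSub]
  · simp [sSub, hij]

theorem det_sSub {n : ℕ} (M : Matrix (Fin n) (Fin n) ℝ) :
    (sSub M).det = algebraMap (Polynomial ℝ) (RatFunc ℝ) M.charpoly := by
  rw [sSub_eq_map, ← RingHom.map_det, Matrix.charpoly]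

theorem sSub_diagonal {n : ℕ} (γ : Fin n → ℝ) :
    sSub (Matrix.diagonal γ) = Matrix.diagonal fun j => RatFunc.X - RatFunc.C (γ j) := by
  ext i j
  by_cases hij : i = j
  · subst hij
    simp [sSub]
  · simp [sSub, hij]

theorem filteredInverse_mul_sSub {n : ℕ} (γ : Fin n → ℝ) (A : Matrix (Fin n) (Fin n) ℝ) :
    filteredInverse γ A * sSub (Matrix.diagonal γ) = sSub (Matrix.diagonal γ + A) := by
  rw [sSub_diagonal]
  ext i j
  have := X_sub_C_ne_zero (γ j)
  rw [Matrix.mul_diagonal]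
  by_cases hij : i = j
  · subst hij
    simp [filteredInverse, sSub, sub_mul, div_mul_cancel₀ _ this]
    ring
  · simp [filteredInverse, sSub, hij, div_mul_cancel₀ _ this]

theorem filteredInverse_mul_filteredTransfer {n : ℕ} (γ : Fin n → ℝ)
    (A : Matrix (Fin n) (Fin n) ℝ) : filteredInverse γ A * filteredTransfer γ A = 1 := by
  rw [filteredTransfer, ← Matrix.mul_assoc, filteredInverse_mul_sSub]
  exact Matrix.mul_nonsing_inv _ (isUnit_det_sSub _)

theorem order_det_filteredInverse {n : ℕ} (γ : Fin n → ℝ) (A : Matrix (Fin n) (Fin n) ℝ)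
    (z : ℂ) : order z (filteredInverse γ A).det =
      ((Matrix.diagonal γ + A).charpoly.map (algebraMap ℝ ℂ)).rootMultiplicity z -
        ((Matrix.diagonal γ).charpoly.map (algebraMap ℝ ℂ)).rootMultiplicity z := by
  have h := congrArg Matrix.det (filteredInverse_mul_sSub γ A)
  rw [Matrix.det_mul] at h
  have h1 := (isUnit_det_sSub (Matrix.diagonal γ + A)).ne_zero
  rw [← h] at h1
  have h2 := order_mul z (left_ne_zero_of_mul h1) (right_ne_zero_of_mul h1)
  rw [h, det_sSub, det_sSub, order_algebraMap, order_algebraMap] at h2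
  omega

/-! ### The pole degrees of the inverse -/

theorem poleDegree_filteredInverse_of_ne {n : ℕ} (γ : Fin n → ℝ) (A : Matrix (Fin n) (Fin n) ℝ)
    {z : ℂ} (hz : ∀ j, (γ j : ℂ) ≠ z) : poleDegree (filteredInverse γ A) z = 0 :=
  poleDegree_eq_zero_of_forall_mem fun _ j =>
    sub_mem (ite_mem_regularAt z _) (C_div_mem_regularAt (hz j) _)

/-- A Schur complement: the right-hand side has no `x⁻¹`, so a perturbation factoring through
dimension `r` costs at most `r` powers of `x`, whatever the size of the minor. -/
theorem pow_mul_det_sub_smul_mul {F k r : Type*} [Field F] [Fintype k] [DecidableEq k]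
    [Fintype r] [DecidableEq r] {x : F} (hx : x ≠ 0) (H : Matrix k k F) (U : Matrix k r F)
    (V : Matrix r k F) :
    x ^ Fintype.card r * (H - x⁻¹ • (U * V)).det =
      (Matrix.fromBlocks (Matrix.scalar r x) V U H).det := by
  have h : Matrix.fromBlocks (Matrix.scalar r x) V U H =
      Matrix.fromBlocks 1 0 (x⁻¹ • U) 1 *
        Matrix.fromBlocks (Matrix.scalar r x) V 0 (H - x⁻¹ • (U * V)) := by
    rw [Matrix.fromBlocks_multiply]
    have : U = x⁻¹ • (U * (Matrix.diagonal fun _ => x : Matrix r r F)) := by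
      rw [← Matrix.smul_one_eq_diagonal, Matrix.mul_smul, Matrix.mul_one,
        smul_smul, inv_mul_cancel₀ hx, one_smul]
    simpa using this
  rw [h, Matrix.det_mul, Matrix.det_fromBlocks_zero₁₂, Matrix.det_fromBlocks_zero₂₁]
  simp

theorem poleDegree_filteredInverse_le {n : ℕ} (γ : Fin n → ℝ) (A : Matrix (Fin n) (Fin n) ℝ)
    (c : ℝ) : poleDegree (filteredInverse γ A) (c : ℂ) ≤ (columnPart γ A c).rank := by
  obtain ⟨k, r, s, hne, hord⟩ := exists_minor_order_eq (filteredInverse γ A) (c : ℂ)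
  obtain ⟨B, D, hBD⟩ := exists_eq_mul_of_rank (columnPart γ A c)
  set x : RatFunc ℝ := RatFunc.X - RatFunc.C c with hx
  have hx0 : x ≠ 0 := X_sub_C_ne_zero c
  -- The part of the minor that is regular at `c`; the rest is `x⁻¹` times a submatrix of
  -- `columnPart`, which factors through its rank.
  let H : Matrix (Fin k) (Fin k) (RatFunc ℝ) := Matrix.of fun i j =>
    (if r i = s j then 1 else 0) -
      if γ (s j) = c then 0 else RatFunc.C (A (r i) (s j)) / (RatFunc.X - RatFunc.C (γ (s j)))
  let U := (B.submatrix r id).map (RatFunc.C (K := ℝ))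
  let V := (D.submatrix id s).map (RatFunc.C (K := ℝ))
  have hUV : U * V = ((columnPart γ A c).submatrix r s).map RatFunc.C := by
    refine Eq.trans ?_ (congrArg (fun M => (M.submatrix r s).map RatFunc.C) hBD.symm)
    simp only [U, V, ← Matrix.map_mul]
    rfl
  have hminor : (filteredInverse γ A).submatrix r s = H - x⁻¹ • (U * V) := by
    rw [hUV]
    ext i j
    by_cases h : γ (s j) = c
    · simp [filteredInverse, H, columnPart_apply, h, hx, div_eq_inv_mul]
    · simp [filteredInverse, H, columnPart_apply, h]
  have hreg : x ^ (columnPart γ A c).rank * ((filteredInverse γ A).submatrix r s).det ∈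
      regularAt (c : ℂ) := by
    have h := pow_mul_det_sub_smul_mul hx0 H U V
    rw [Fintype.card_fin] at h
    rw [hminor, h]
    refine det_mem_of_forall_mem _ ?_
    rintro (i | i) (j | j)
    · simp only [Matrix.fromBlocks_apply₁₁, Matrix.scalar_apply, Matrix.diagonal_apply]
      split_ifs
      · rw [hx, X_sub_C_eq]
        exact algebraMap_mem_regularAt _ _
      · exact zero_mem _
    · exact C_mem_regularAt _ _
    · exact C_mem_regularAt _ _
    · refine sub_mem (ite_mem_regularAt _ _) ?_
      split_ifs with h
      · exact zero_mem _
      · exact C_div_mem_regularAt (by exact_mod_cast h) _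
  have h1 := order_nonneg_of_mem_regularAt hreg
  rw [order_mul _ (pow_ne_zero _ hx0) hne, order_pow _ hx0, order_X_sub_C] at h1
  omega

theorem le_poleDegree_filteredInverse {n : ℕ} (γ : Fin n → ℝ) (A : Matrix (Fin n) (Fin n) ℝ)
    (c : ℝ) : (columnPart γ A c).rank ≤ poleDegree (filteredInverse γ A) (c : ℂ) := by
  obtain ⟨r, s, hdet⟩ := exists_submatrix_det_ne_zero (columnPart γ A c)
  -- A nonzero minor cannot use a column that was set to zero.
  have hs : ∀ j, γ (s j) = c := fun j => by
    by_contra h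
    exact hdet (Matrix.det_eq_zero_of_column_eq_zero j fun _ => by simp [columnPart_apply, h])
  set x : RatFunc ℝ := RatFunc.X - RatFunc.C c with hx
  have hx0 : x ≠ 0 := X_sub_C_ne_zero c
  -- This is `s - c` times the minor's matrix. At `s = c` only the negated submatrix of `columnPart`
  -- survives, so `P.det` does not vanish there and the pole has the full order.
  let P : Matrix (Fin (columnPart γ A c).rank) (Fin (columnPart γ A c).rank) (Polynomial ℝ) :=
    Matrix.of fun i j => (if r i = s j then Polynomial.X - Polynomial.C c else 0) -
      Polynomial.C (A (r i) (s j))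
  have hP : Polynomial.eval c P.det ≠ 0 := by
    have h : (Polynomial.evalRingHom c).mapMatrix P = -(columnPart γ A c).submatrix r s := by
      ext i j
      simp only [P, RingHom.mapMatrix_apply, Matrix.map_apply, Matrix.of_apply,
        Polynomial.coe_evalRingHom, Polynomial.eval_sub, Polynomial.eval_C, Matrix.neg_apply,
        Matrix.submatrix_apply, columnPart_apply, hs, if_true]
      split_ifs <;> simp
    rw [← Polynomial.coe_evalRingHom, RingHom.map_det, h, Matrix.det_neg]
    exact mul_ne_zero (pow_ne_zero _ (by norm_num)) hdet
  have hmap : x • (filteredInverse γ A).submatrix r s =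
      (algebraMap (Polynomial ℝ) (RatFunc ℝ)).mapMatrix P := by
    ext i j
    have : x * (RatFunc.C (A (r i) (s j)) / (RatFunc.X - RatFunc.C (γ (s j)))) =
        RatFunc.C (A (r i) (s j)) := by rw [hs, ← hx, mul_div_cancel₀ _ hx0]
    simp only [P, Matrix.smul_apply, filteredInverse, Matrix.submatrix_apply, Matrix.of_apply,
      smul_eq_mul, mul_sub, this, RingHom.mapMatrix_apply, Matrix.map_apply, map_sub,
      RatFunc.algebraMap_C]
    split_ifs <;> simp [hx]
  have h1 := congrArg Matrix.det hmap
  rw [Matrix.det_smul, Fintype.card_fin, ← RingHom.map_det] at h1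
  have hPC : order (c : ℂ) (algebraMap (Polynomial ℝ) (RatFunc ℝ) P.det) = 0 := by
    rw [order_algebraMap, Polynomial.rootMultiplicity_eq_zero, Nat.cast_zero]
    intro h
    have h' : (algebraMap ℝ ℂ) (Polynomial.eval c P.det) = 0 := by
      rw [← Polynomial.eval_map_apply]
      exact h
    exact hP (by simpa using h')
  have hne : x ^ (columnPart γ A c).rank * ((filteredInverse γ A).submatrix r s).det ≠ 0 := by
    rw [h1]
    refine RatFunc.algebraMap_ne_zero fun h => hP (by simp [h])
  have h2 := congrArg (order (c : ℂ)) h1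
  rw [order_mul _ (left_ne_zero_of_mul hne) (right_ne_zero_of_mul hne), order_pow _ hx0,
    order_X_sub_C, hPC] at h2
  have h3 := neg_order_minor_le (filteredInverse γ A) (c : ℂ) r s
  omega

theorem poleDegree_filteredInverse {n : ℕ} (γ : Fin n → ℝ) (A : Matrix (Fin n) (Fin n) ℝ)
    (c : ℝ) : poleDegree (filteredInverse γ A) (c : ℂ) = (columnPart γ A c).rank :=
  le_antisymm (poleDegree_filteredInverse_le γ A c) (le_poleDegree_filteredInverse γ A c)

/-! ### The McMillan degree of the filtered transfer function -/

/-- The rational functions of degree at most `d`. -/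
def degreeLE (d : ℤ) : AddSubmonoid (RatFunc ℝ) where
  carrier := {f | f = 0 ∨ f.intDegree ≤ d}
  zero_mem' := Or.inl rfl
  add_mem' {f g} hf hg := by
    by_cases hg0 : g = 0
    · simpa [hg0] using hf
    by_cases hf0 : f = 0
    · simpa [hf0] using hg
    by_cases h : f + g = 0
    · exact Or.inl h
    · exact Or.inr ((RatFunc.intDegree_add_le hg0 h).trans
        (max_le (hf.resolve_left hf0) (hg.resolve_left hg0)))

theorem mem_degreeLE {d : ℤ} {f : RatFunc ℝ} : f ∈ degreeLE d ↔ f = 0 ∨ f.intDegree ≤ d :=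
  Iff.rfl

theorem mul_mem_degreeLE {d e : ℤ} {f g : RatFunc ℝ} (hf : f ∈ degreeLE d)
    (hg : g ∈ degreeLE e) : f * g ∈ degreeLE (d + e) := by
  rw [mem_degreeLE] at *
  by_cases hf0 : f = 0
  · simp [hf0]
  by_cases hg0 : g = 0
  · simp [hg0]
  right
  rw [RatFunc.intDegree_mul hf0 hg0]
  exact add_le_add (hf.resolve_left hf0) (hg.resolve_left hg0)

theorem C_div_mem_degreeLE (a b : ℝ) :
    RatFunc.C a / (RatFunc.X - RatFunc.C b) ∈ degreeLE (-1) := by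
  by_cases ha : a = 0
  · simp [ha]
  right
  rw [RatFunc.intDegree_div (by simpa using ha) (X_sub_C_ne_zero b), RatFunc.intDegree_C,
    X_sub_C_eq, RatFunc.intDegree_polynomial]
  simp

theorem filteredTransfer_apply {n : ℕ} (γ : Fin n → ℝ) (A : Matrix (Fin n) (Fin n) ℝ)
    (i j : Fin n) : filteredTransfer γ A i j = (if i = j then 1 else 0) +
      ∑ k, RatFunc.C (A i k) / (RatFunc.X - RatFunc.C (γ k)) * filteredTransfer γ A k j := by
  have h := congrFun (congrFun (filteredInverse_mul_filteredTransfer γ A) i) j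
  rw [Matrix.mul_apply, Matrix.one_apply] at h
  simp only [filteredInverse, Matrix.of_apply, sub_mul, ite_mul, one_mul, zero_mul,
    Finset.sum_sub_distrib, Finset.sum_ite_eq, Finset.mem_univ, if_true] at h
  rw [← h, sub_add_cancel]

/-- In `G = I + A (sI - Γ)⁻¹ G` the factor `(sI - Γ)⁻¹` lowers degrees by one, so a positive degree
bound on a column improves until the constant term `I` stops it at `0`. -/
theorem filteredTransfer_mem_degreeLE {n : ℕ} (γ : Fin n → ℝ) (A : Matrix (Fin n) (Fin n) ℝ)
    (j : Fin n) (d : ℕ) (hd : ∀ i, filteredTransfer γ A i j ∈ degreeLE d) (i : Fin n) :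
    filteredTransfer γ A i j ∈ degreeLE 0 := by
  induction d generalizing i with
  | zero => exact hd i
  | succ d ih =>
    refine ih (fun i => ?_) i
    rw [filteredTransfer_apply]
    refine add_mem ?_ (sum_mem fun k _ => ?_)
    · split_ifs
      · exact Or.inr (by simp)
      · exact zero_mem _
    · have := mul_mem_degreeLE (C_div_mem_degreeLE (A i k) (γ k)) (hd k)
      rwa [Nat.cast_succ, neg_add_cancel_comm_assoc] at this

/-- The filtered transfer function is proper. -/
theorem not_isPole_infty_filteredTransfer {n : ℕ} (γ : Fin n → ℝ)
    (A : Matrix (Fin n) (Fin n) ℝ) : ¬IsPole (filteredTransfer γ A) ∞ := by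
  rintro ⟨i, j, hij⟩
  have hij' : 0 < (filteredTransfer γ A i j).num.natDegree -
    (filteredTransfer γ A i j).denom.natDegree := hij
  have h := filteredTransfer_mem_degreeLE γ A j
    (Finset.univ.sup fun i => (filteredTransfer γ A i j).intDegree.toNat)
    (fun i => Or.inr ((Int.self_le_toNat _).trans (Int.ofNat_le.2
      (Finset.le_sup (f := fun i => (filteredTransfer γ A i j).intDegree.toNat)
        (Finset.mem_univ i))))) i
  rcases h with h | h
  · simp [h] at hij'
  · rw [RatFunc.intDegree] at h
    omega

theorem sum_rootMultiplicity_map {S : Finset ℂ} {p : Polynomial ℝ}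
    (h : (p.map (algebraMap ℝ ℂ)).roots.toFinset ⊆ S) :
    ∑ z ∈ S, (p.map (algebraMap ℝ ℂ)).rootMultiplicity z = p.natDegree := by
  simp_rw [← Polynomial.count_roots]
  rw [Multiset.sum_count_eq_card fun z hz => h (Multiset.mem_toFinset.2 hz),
    ← Polynomial.natDegree_map (algebraMap ℝ ℂ)]
  exact (IsAlgClosed.splits _).natDegree_eq_card_roots.symm

theorem mcMillanDegree_filteredTransfer {n : ℕ} (γ : Fin n → ℝ) (A : Matrix (Fin n) (Fin n) ℝ) :
    mcMillanDegree (filteredTransfer γ A) =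
      ∑ c ∈ Finset.univ.image γ, (columnPart γ A c).rank := by
  classical
  set G := filteredTransfer γ A with hG
  set K := filteredInverse γ A
  set p := (Matrix.diagonal γ + A).charpoly with hp
  set q := (Matrix.diagonal γ).charpoly with hq
  let T : Finset ℂ := (Finset.univ.image γ).image (fun c : ℝ => (c : ℂ))
  let Q : Finset ℂ := (finite_poles G).toFinset.preimage (OnePoint.some : ℂ → OnePoint ℂ)
    (OnePoint.coe_injective.injOn)
  -- One finite set containing the finite poles of `G`, the values of `γ` and all roots of `p` and
  -- `q`, so that every sum can run over it.
  let S : Finset ℂ := (p.map (algebraMap ℝ ℂ)).roots.toFinset ∪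
    (q.map (algebraMap ℝ ℂ)).roots.toFinset ∪ T ∪ Q
  have hsum : mcMillanDegree G = ∑ z ∈ S, poleDegree G (z : OnePoint ℂ) := by
    have h1 : (finite_poles G).toFinset = Q.image (OnePoint.some : ℂ → OnePoint ℂ) := by
      ext x
      induction x using OnePoint.rec with
      | infty =>
        have := not_isPole_infty_filteredTransfer γ A
        simpa [Q] using this
      | coe z => simp [Q]
    rw [mcMillanDegree, h1, Finset.sum_image OnePoint.coe_injective.injOn]
    refine Finset.sum_subset Finset.subset_union_right fun z _ hz => ?_
    exact poleDegree_eq_zero_of_forall_mem (mem_regularAt_of_not_isPole (by simpa [Q] using hz))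
  have hsumK : ∑ z ∈ S, poleDegree K (z : OnePoint ℂ) =
      ∑ c ∈ Finset.univ.image γ, (columnPart γ A c).rank := by
    have hTS : T ⊆ S := Finset.subset_union_right.trans Finset.subset_union_left
    rw [← Finset.sum_subset hTS, Finset.sum_image Complex.ofReal_injective.injOn]
    · exact Finset.sum_congr rfl fun c _ => poleDegree_filteredInverse γ A c
    · intro z _ hz
      refine poleDegree_filteredInverse_of_ne γ A fun j hj => hz ?_
      simp only [T, Finset.mem_image, Finset.mem_univ, true_and]
      exact ⟨γ j, ⟨j, rfl⟩, hj⟩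
  have hp' := sum_rootMultiplicity_map (S := S) (p := p)
    (Finset.subset_union_left.trans (Finset.subset_union_left.trans Finset.subset_union_left))
  have hq' := sum_rootMultiplicity_map (S := S) (p := q)
    (Finset.subset_union_right.trans (Finset.subset_union_left.trans Finset.subset_union_left))
  have hdeg : p.natDegree = q.natDegree := by
    rw [hp, hq, Matrix.charpoly_natDegree_eq_dim, Matrix.charpoly_natDegree_eq_dim]
  rw [hsum, ← hsumK]
  have h := Finset.sum_congr rfl fun z (_ : z ∈ S) =>
    poleDegree_eq_add_order_det (filteredInverse_mul_filteredTransfer γ A) z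
  simp_rw [order_det_filteredInverse] at h
  rw [Finset.sum_add_distrib, Finset.sum_sub_distrib] at h
  zify at hp' hq' hdeg ⊢
  rw [hp', hq', hdeg, sub_self, add_zero] at h
  exact h

/-! ### Matchings and generic ranks -/

theorem card_le_matchingNumber {n : ℕ} {G : Digraph (Fin n)} {M : Finset (Fin n × Fin n)}
    (h : IsMatching G M) : M.card ≤ matchingNumber G := by
  classical
  exact Finset.le_sup (f := Finset.card) (by simpa using h)

theorem exists_isMatching_card_eq {n : ℕ} (G : Digraph (Fin n)) :
    ∃ M, IsMatching G M ∧ M.card = matchingNumber G := by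
  classical
  obtain ⟨M, hM, hcard⟩ := Finset.exists_mem_eq_sup
    (Finset.univ.filter fun M : Finset (Fin n × Fin n) => IsMatching G M)
    ⟨∅, by simp [IsMatching]⟩ Finset.card
  exact ⟨M, by simpa using hM, by rw [← hcard, matchingNumber]⟩

/-- The rank of a matrix supported on the edges of `G` is at most the matching number. -/
theorem rank_le_matchingNumber {n : ℕ} {K : Type*} [Field K] {G : Digraph (Fin n)}
    {A : Matrix (Fin n) (Fin n) K} (hA : ∀ i j, A i j ≠ 0 → G.Adj j i) :
    A.rank ≤ matchingNumber G := by
  obtain ⟨r, c, hdet⟩ := exists_submatrix_det_ne_zero A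
  -- A nonzero term of the Leibniz expansion selects one edge per row and column: a matching.
  rw [Matrix.det_apply] at hdet
  obtain ⟨σ, -, hσ⟩ := Finset.exists_ne_zero_of_sum_ne_zero hdet
  have hne : ∀ i, A (r (σ i)) (c i) ≠ 0 := fun i h =>
    hσ (by rw [Finset.prod_eq_zero (Finset.mem_univ i) h, smul_zero])
  let f : Fin A.rank ↪ Fin n × Fin n :=
    ⟨fun i => (c i, r (σ i)), fun i j h => c.injective (congrArg Prod.fst h)⟩
  have hM : IsMatching G (Finset.univ.map f) := by
    constructor
    · intro e he
      obtain ⟨i, -, rfl⟩ := Finset.mem_map.1 he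
      exact hA _ _ (hne i)
    · intro e he e' he' hee'
      obtain ⟨i, -, rfl⟩ := Finset.mem_map.1 he
      obtain ⟨j, -, rfl⟩ := Finset.mem_map.1 he'
      have hij : i ≠ j := fun h => hee' (by rw [h])
      exact ⟨fun h => hij (c.injective h), fun h => hij (σ.injective (r.injective h))⟩
  simpa using card_le_matchingNumber hM

/-- A matching is the graph of a bijection between two lists of distinct nodes. -/
theorem exists_embeddings_of_isMatching {n : ℕ} {G : Digraph (Fin n)}
    {M : Finset (Fin n × Fin n)} (hM : IsMatching G M) :
    ∃ c r : Fin M.card ↪ Fin n, ∀ i, G.Adj (c i) (r i) := by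
  let e := M.equivFin.symm
  refine ⟨⟨fun i => (e i).1.1, fun i j h => ?_⟩, ⟨fun i => (e i).1.2, fun i j h => ?_⟩,
    fun i => hM.1 _ (e i).2⟩ <;> by_contra hij
  · exact (hM.2 _ (e i).2 _ (e j).2 fun h => hij (e.injective (Subtype.ext h))).1 h
  · exact (hM.2 _ (e i).2 _ (e j).2 fun h => hij (e.injective (Subtype.ext h))).2 h

open Classical in
/-- The weight matrix with indeterminate edge weights. -/
def genericWeightMatrix {n : ℕ} (G : Digraph (Fin n)) :
    Matrix (Fin n) (Fin n) (MvPolynomial (Edge G) ℝ) :=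
  Matrix.of fun i j => if h : G.Adj j i then MvPolynomial.X ⟨(j, i), h⟩ else 0

theorem eval_genericWeightMatrix {n : ℕ} (G : Digraph (Fin n)) (a : Edge G → ℝ) (i j : Fin n) :
    MvPolynomial.eval a (genericWeightMatrix G i j) = weightMatrix G a i j := by
  simp only [genericWeightMatrix, weightMatrix, Matrix.of_apply]
  split_ifs <;> simp

theorem eval_det_genericWeightMatrix {n k : ℕ} (G : Digraph (Fin n)) (a : Edge G → ℝ)
    (r c : Fin k → Fin n) :
    MvPolynomial.eval a ((genericWeightMatrix G).submatrix r c).det =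
      ((weightMatrix G a).submatrix r c).det := by
  rw [RingHom.map_det]
  congr 1
  ext i j
  exact eval_genericWeightMatrix G a _ _

/-- Weight `1` on the matched edges and `0` elsewhere specialises the submatrix to the identity. -/
theorem det_genericWeightMatrix_ne_zero {n k : ℕ} {G : Digraph (Fin n)} {c r : Fin k ↪ Fin n}
    (h : ∀ i, G.Adj (c i) (r i)) : ((genericWeightMatrix G).submatrix r c).det ≠ 0 := by
  classical
  intro h0
  have h1 := eval_det_genericWeightMatrix G
    (fun e => if ∃ i, e.1 = (c i, r i) then 1 else 0) r c
  have h2 : (weightMatrix G fun e => if ∃ i, e.1 = (c i, r i) then 1 else 0).submatrix r c = 1 := by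
    ext i j
    rw [Matrix.submatrix_apply, Matrix.one_apply, weightMatrix, Matrix.of_apply]
    by_cases hij : i = j
    · subst hij
      simp [h]
    · have : ¬∃ l, (c j, r i) = (c l, r l) := by
        rintro ⟨l, hl⟩
        rw [Prod.mk.injEq] at hl
        exact hij ((r.injective hl.2).trans (c.injective hl.1).symm)
      simp only [if_neg this, dite_eq_ite, ite_self, if_neg hij]
  rw [h0, h2, Matrix.det_one, map_zero] at h1
  exact zero_ne_one h1

theorem rank_columnPart_le {n : ℕ} (γ : Fin n → ℝ) (G : Digraph (Fin n)) (a : Edge G → ℝ)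
    (c : ℝ) : (columnPart γ (weightMatrix G a) c).rank ≤
      matchingNumber (outgoingSubgraph G {j | γ j = c}) := by
  refine rank_le_matchingNumber fun i j h => ?_
  simp only [columnPart_apply, weightMatrix, Matrix.of_apply, ne_eq, ite_eq_right_iff,
    dite_eq_right_iff, not_forall] at h
  obtain ⟨h1, h2, -⟩ := h
  exact ⟨h1, h2⟩

theorem exists_polynomial_rank_columnPart {n : ℕ} (γ : Fin n → ℝ) (G : Digraph (Fin n)) (c : ℝ) :
    ∃ p : MvPolynomial (Edge G) ℝ, p ≠ 0 ∧ ∀ a, MvPolynomial.eval a p ≠ 0 →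
      (columnPart γ (weightMatrix G a) c).rank =
        matchingNumber (outgoingSubgraph G {j | γ j = c}) := by
  obtain ⟨M, hM, hcard⟩ := exists_isMatching_card_eq (outgoingSubgraph G {j | γ j = c})
  obtain ⟨s, r, hsr⟩ := exists_embeddings_of_isMatching hM
  refine ⟨_, det_genericWeightMatrix_ne_zero fun i => (hsr i).2, fun a ha => ?_⟩
  refine le_antisymm (rank_columnPart_le γ G a c) ?_
  rw [eval_det_genericWeightMatrix] at ha
  -- All start nodes `s j` of the matching have parameter `c`, so no selected column is set to zero.
  have h : (weightMatrix G a).submatrix r s =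
      (columnPart γ (weightMatrix G a) c).submatrix r s := by
    ext i j
    have : γ (s j) = c := (hsr j).1
    simp [columnPart_apply, this]
  rw [h] at ha
  calc _ = Fintype.card (Fin M.card) := by rw [Fintype.card_fin, hcard]
    _ = _ := (Matrix.rank_of_det_ne_zero ha).symm
    _ ≤ _ := Matrix.rank_submatrix_le _ _ _

theorem complexity_le {n : ℕ} (γ : Fin n → ℝ) (G : Digraph (Fin n)) (a : Edge G → ℝ) :
    complexity γ G a ≤
      ∑ c ∈ Finset.univ.image γ, matchingNumber (outgoingSubgraph G {j | γ j = c}) := by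
  rw [complexity, mcMillanDegree_filteredTransfer]
  exact Finset.sum_le_sum fun c _ => rank_columnPart_le γ G a c

theorem exists_polynomial_complexity_eq {n : ℕ} (γ : Fin n → ℝ) (G : Digraph (Fin n)) :
    ∃ p : MvPolynomial (Edge G) ℝ, p ≠ 0 ∧ ∀ a, MvPolynomial.eval a p ≠ 0 →
      complexity γ G a =
        ∑ c ∈ Finset.univ.image γ, matchingNumber (outgoingSubgraph G {j | γ j = c}) := by
  choose p hp0 hp using exists_polynomial_rank_columnPart γ G
  refine ⟨∏ c ∈ Finset.univ.image γ, p c, Finset.prod_ne_zero_iff.2 fun c _ => hp0 c,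
    fun a ha => ?_⟩
  rw [map_prod, Finset.prod_ne_zero_iff] at ha
  rw [complexity, mcMillanDegree_filteredTransfer]
  exact Finset.sum_congr rfl fun c hc => hp c a (ha c hc)

theorem isGreatest_complexity {n : ℕ} (γ : Fin n → ℝ) (G : Digraph (Fin n)) :
    IsGreatest (Set.range fun a : Edge G → ℝ => complexity γ G a)
      (∑ c ∈ Finset.univ.image γ, matchingNumber (outgoingSubgraph G {j | γ j = c})) := by
  constructor
  · obtain ⟨p, hp0, hp⟩ := exists_polynomial_complexity_eq γ G
    -- Over the infinite field `ℝ` a nonzero polynomial is nonzero somewhere, so the generic value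
    -- is attained.
    obtain ⟨a, ha⟩ : ∃ a, MvPolynomial.eval a p ≠ 0 := by
      by_contra! h
      exact hp0 (MvPolynomial.funext fun a => by rw [h a, map_zero])
    exact ⟨a, hp a ha⟩
  · rintro _ ⟨a, rfl⟩
    exact complexity_le γ G a

end NetworkComplexity

end

theorem mainTheorem1 (n : ℕ) (γ : Fin n → ℝ) (G : Digraph (Fin n)) :
    -- the structural complexity is an attained maximum
    IsGreatest (Set.range fun a : NetworkComplexity.Edge G → ℝ =>
        NetworkComplexity.complexity γ G a)
      (NetworkComplexity.structuralComplexity γ G) ∧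
    -- it is the complexity for all weights off the zero set of a nonzero polynomial
    (∃ p : MvPolynomial (NetworkComplexity.Edge G) ℝ, p ≠ 0 ∧
      ∀ a : NetworkComplexity.Edge G → ℝ, MvPolynomial.eval a p ≠ 0 →
        NetworkComplexity.complexity γ G a = NetworkComplexity.structuralComplexity γ G) ∧
    -- it is the sum of the matching numbers over the distinct values of `γ`
    NetworkComplexity.structuralComplexity γ G =
      ∑ c ∈ Finset.univ.image γ,
        NetworkComplexity.matchingNumber
          (NetworkComplexity.outgoingSubgraph G {j | γ j = c}) := by
  have hG := NetworkComplexity.isGreatest_complexity γ G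
  have h : NetworkComplexity.structuralComplexity γ G =
      ∑ c ∈ Finset.univ.image γ, NetworkComplexity.matchingNumber
        (NetworkComplexity.outgoingSubgraph G {j | γ j = c}) := hG.csSup_eq
  rw [h]
  exact ⟨hG, NetworkComplexity.exists_polynomial_complexity_eq γ G, rfl⟩
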